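/- Let $\Gamma$ be a compact metric graph: finite sets $V$ of vertices and $E$ of edges (loops, multiple edges and disconnected graphs are allowed), each edge $e$ being parametrized by $[0,L(e)]$ with $L(e)\in(0,\infty)$. Let $q=(q_e)_{e\in E}\in L^\infty(\Gamma)$ be real-valued. For $f=(f_e)_{e\in E}$ with $f_e\in H^2(0,L(e))$ and a vertex $v$ of degree $d=\deg(v)$ (loops count twice), let $F(v)\in\mathbb C^{d}$ be the vector of the boundary values at $v$ of the functions $f_e$, $e$ incident to $v$, and $F'(v)\in\mathbb C^{d}$ the vector of the derivatives at $v$ taken in the direction out of $v$ into the edges. For each $v$ let $P_{v,D},P_{v,N},P_{v,R}$ be orthogonal projections in $\mathbb C^{d}$ with mutually orthogonal ranges and $P_{v,D}+P_{v,N}+P_{v,R}=I$, and let $\Lambda_v$ be a self-adjoint operator in $\operatorname{ran}P_{v,R}$ (not necessarily invertible). Let $H$ be the operator in $L^2(\Gamma)=\bigoplus_{e}L^2(0,L(e))$ given by $(Hf)_e=-f_e''+q_ef_e$ on the domain of all $f\in\bigoplus_eH^2(0,L(e))$ with $$P_{v,D}F(v)=0,\qquad P_{v,N}F'(v)=0,\qquad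 P_{v,R}F'(v)=\Lambda_vP_{v,R}F(v)\qquad\text{for every } v\in V,$$ and let $\lambda_1(H)\le\lambda_2(H)\le\dots$ be its eigenvalues, counted with multiplicities; that is, $\lambda_k(H)$ is the least $x$ such that at least $k$ eigenvalues, counted with multiplicities, lie in $(-\infty,x]$, understood as an infimum in $[-\infty,\infty]$. Let $t>0$, let $\widetilde\Gamma$ be the metric graph with the same vertices and edges and with edge lengths $\widetilde L(e)=tL(e)$, and put $\widetilde q_e(x)=t^{-2}q_e(x/t)$. (i) Let $\widetilde H$ be the operator on $\widetilde\Gamma$ with potential $\widetilde q$ and with vertex conditions given by the same projections $P_{v,D},P_{v,N},P_{v,R}$ and by $\widetilde\Lambda_v=\frac1t\Lambda_v$. Then $$\lambda_k(\widetilde H)=\frac1{t^2}\lambda_k(H)\qquad\text{for all } k=1,2,\dots$$ (ii) For $d=\deg(v)$ let $\mathcal P$ and $\mathcal Q$ be the orthogonal projections in $\mathbb C^{d}$ onto the span of $(1,\dots,1)^\top$ and onto its orthogonal complement. A $\delta$ coupling of strength $\alpha\in\mathbb R$ at $v$ is the condition with $P_{v,D}=\mathcal Q$, $P_{v,N}=0$,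 $P_{v,R}=\mathcal P$, $\Lambda_v=\alpha/d$; a $\delta'$ coupling of strength $\beta\in\mathbb R\setminus\{0\}$ at $v$ is the condition with $P_{v,D}=0$, $P_{v,N}=\mathcal Q$, $P_{v,R}=\mathcal P$, $\Lambda_v=d/\beta$. Suppose that $H$ has at each vertex $v$ either a $\delta$ coupling of strength $\alpha_v$ or a $\delta'$ coupling of strength $\beta_v$, and let $\widetilde H$ be the operator on $\widetilde\Gamma$ with potential $\widetilde q$ and with, respectively, a $\delta$ coupling of strength $\alpha_v/t$ or a $\delta'$ coupling of strength $t\beta_v$ at $v$. Then again $\lambda_k(\widetilde H)=\frac1{t^2}\lambda_k(H)$ for all $k=1,2,\dots$ -/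

import Mathlib

open MeasureTheory Set
open scoped ContDiff ENNReal

noncomputable section

/-! ### Eigenvalues of (unbounded) operators, counted with multiplicity -/

section Eigenvalues

variable {X : Type*} [AddCommGroup X] [Module ℂ X]

/-- The kernel of `T - μ`, for an operator `T` in `X` that need not be everywhere defined. -/
def opEigenspace (T : X →ₗ.[ℂ] X) (μ : ℂ) : Submodule ℂ X where
  carrier := {f | ∃ h : f ∈ T.domain, T ⟨f, h⟩ = μ • f}
  zero_mem' := ⟨T.domain.zero_mem, by
    rw [smul_zero]; exact T.map_zero⟩
  add_mem' := by
    rintro a b ⟨ha, hTa⟩ ⟨hb, hTb⟩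
    refine ⟨T.domain.add_mem ha hb, ?_⟩
    rw [smul_add, ← hTa, ← hTb]
    exact T.map_add ⟨a, ha⟩ ⟨b, hb⟩
  smul_mem' := by
    rintro c a ⟨ha, hTa⟩
    refine ⟨T.domain.smul_mem c ha, ?_⟩
    rw [smul_comm, ← hTa]
    exact T.map_smul c ⟨a, ha⟩

/-- The multiplicity `dim ker (T - μ)` of the real number `μ` (zero if it is not an eigenvalue). -/
def eigMultiplicity (T : X →ₗ.[ℂ] X) (μ : ℝ) : ℕ∞ :=
  Cardinal.toENat (Module.rank ℂ (opEigenspace T (μ : ℂ)))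

/-- The number of real eigenvalues of `T` in `(-∞, x]`, counted with multiplicities, i.e.
the (possibly infinite) sum of the multiplicities of all `μ ≤ x`. -/
def eigCount (T : X →ₗ.[ℂ] X) (x : ℝ) : ℕ∞ :=
  ⨆ s : Finset (Iic x), ∑ μ ∈ s, eigMultiplicity T (μ : ℝ)

/-- The `k`-th eigenvalue of `T` (`k = 1, 2, …`), eigenvalues being put in non-decreasing order
and counted with multiplicities: the least `x` such that at least `k` eigenvalues lie in
`(-∞, x]`. It is an extended real so that no default value is ever used. -/
def eigenvalue (T : X →ₗ.[ℂ] X) (k : ℕ) : EReal :=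
  ⨅ x ∈ {x : ℝ | (k : ℕ∞) ≤ eigCount T x}, (x : EReal)

/-- If `l 0 ≤ l 1 ≤ …` is the list of all eigenvalues in which each one is repeated according to
its multiplicity, then `eigenvalue T k` is its `k`-th member. -/
theorem eigenvalue_eq_of_list (T : X →ₗ.[ℂ] X) (l : ℕ → ℝ) (hl : Monotone l)
    (hm : ∀ μ : ℝ, {j | l j = μ}.encard = eigMultiplicity T μ) (k : ℕ) :
    eigenvalue T (k + 1) = (l k : EReal) := by
  have key : ∀ x : ℝ, (((k + 1 : ℕ) : ℕ∞) ≤ eigCount T x) ↔ l k ≤ x := by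
    intro x
    have hsum : ∀ s : Finset (Iic x), ∑ μ ∈ s, eigMultiplicity T (μ : ℝ)
        = (⋃ μ ∈ s, {j | l j = (μ : ℝ)}).encard := by
      intro s
      classical
      induction s using Finset.induction_on with
      | empty => simp
      | insert a s ha ih =>
        rw [Finset.sum_insert ha, Finset.set_biUnion_insert, Set.encard_union_eq, ih, hm]
        rw [Set.disjoint_left]
        intro j hj hj'
        simp only [mem_iUnion, mem_ofPred_eq] at hj hj'
        obtain ⟨b, hb, hjb⟩ := hj'
        have : a = b := Subtype.ext (by rw [← hj, ← hjb])
        exact ha (this ▸ hb)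
    constructor
    · intro h
      by_contra hx
      push Not at hx
      have hle : eigCount T x ≤ (k : ℕ∞) := by
        refine iSup_le fun s => ?_
        rw [hsum]
        have hsub : (⋃ μ ∈ s, {j | l j = (μ : ℝ)}) ⊆ ((Finset.range k : Finset ℕ) : Set ℕ) := by
          intro j hj
          simp only [mem_iUnion, mem_ofPred_eq] at hj
          obtain ⟨b, _, hjb⟩ := hj
          have hb : (b : ℝ) ≤ x := b.2
          simp only [Finset.coe_range, mem_Iio]
          by_contra hkj
          push Not at hkj
          have := hl hkj
          linarith
        refine (Set.encard_le_encard hsub).trans ?_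
        rw [Set.encard_coe_eq_coe_finsetCard, Finset.card_range]
      have := h.trans hle
      norm_cast at this
      omega
    · intro h
      classical
      let s : Finset (Iic x) := (Finset.univ : Finset (Fin (k + 1))).image
        fun j : Fin (k + 1) => ⟨l (j : ℕ), (hl (Nat.lt_succ_iff.mp j.2)).trans h⟩
      refine le_trans ?_ (le_iSup _ s)
      rw [hsum]
      have hsub : ((Finset.range (k + 1) : Finset ℕ) : Set ℕ) ⊆ ⋃ μ ∈ s, {j | l j = (μ : ℝ)} := by
        intro j hj
        simp only [Finset.coe_range, mem_Iio] at hj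
        simp only [mem_iUnion, mem_ofPred_eq]
        exact ⟨⟨l j, (hl (Nat.lt_succ_iff.mp hj)).trans h⟩,
          Finset.mem_image.mpr ⟨(⟨j, hj⟩ : Fin (k + 1)), Finset.mem_univ _, rfl⟩, rfl⟩
      refine le_trans ?_ (Set.encard_le_encard hsub)
      rw [Set.encard_coe_eq_coe_finsetCard, Finset.card_range]
  have hset : {x : ℝ | ((k + 1 : ℕ) : ℕ∞) ≤ eigCount T x} = Ici (l k) := by
    ext x; exact key x
  rw [eigenvalue, hset]
  apply le_antisymm
  · exact iInf₂_le (l k) (mem_Ici.mpr le_rfl)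
  · exact le_iInf₂ fun x hx => EReal.coe_le_coe_iff.mpr hx

end Eigenvalues

/-! ### Compact metric graphs -/

/-- An oriented combinatorial graph; loops, multiple edges and isolated vertices are allowed. -/
structure CombGraph (V E : Type*) where
  /-- the vertex from which an edge originates -/
  orig : E → V
  /-- the vertex at which an edge terminates -/
  term : E → V

/-- A metric graph: the edge `e` is parametrized by `[0, len e]`, with `0` at `orig e` and
`len e` at `term e`. It is compact if `V` and `E` are finite. -/
structure MetricGraph (V E : Type*) extends CombGraph V E where
  /-- the length function -/
  len : E → ℝ
  len_pos : ∀ e, 0 < len e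

namespace CombGraph

variable {V E : Type*} (G : CombGraph V E)

/-- The ends of edges at the vertex `v`: `(e, false)` if `e` originates from `v` and `(e, true)`
if `e` terminates at `v` (a loop at `v` occurs twice). -/
def EndsAt (v : V) : Type _ :=
  {h : E × Bool // (if h.2 then G.term h.1 else G.orig h.1) = v}

instance [Finite E] (v : V) : Fintype (G.EndsAt v) :=
  letI : Finite (G.EndsAt v) := Subtype.finite
  Fintype.ofFinite _

/-- The degree of a vertex (loops count twice). -/
def deg [Finite E] (v : V) : ℕ := Fintype.card (G.EndsAt v)

/-- The space `ℂ ^ deg v` of boundary values at `v`. -/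
abbrev BdrySpace [Finite E] (v : V) : Type _ := EuclideanSpace ℂ (G.EndsAt v)

/-- The data of a self-adjoint vertex condition at `v`: orthogonal projections `PD`, `PN`, `PR`
with mutually orthogonal ranges and sum `1`, and a self-adjoint operator `Λ` in the range
of `PR`. The operator `Λ` may have a kernel, so that a `δ` condition of strength zero
is included. -/
structure VertexCondition [Finite E] (v : V) where
  PD : G.BdrySpace v →L[ℂ] G.BdrySpace v
  PN : G.BdrySpace v →L[ℂ] G.BdrySpace v
  PR : G.BdrySpace v →L[ℂ] G.BdrySpace v
  isStarProjection_PD : IsStarProjection PD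
  isStarProjection_PN : IsStarProjection PN
  isStarProjection_PR : IsStarProjection PR
  range_PD_orthogonal_range_PN : PD.range ⟂ PN.range
  range_PD_orthogonal_range_PR : PD.range ⟂ PR.range
  range_PN_orthogonal_range_PR : PN.range ⟂ PR.range
  sum_eq_one : PD + PN + PR = 1
  /-- the strength operator -/
  Λ : PR.range →ₗ[ℂ] PR.range
  isSymmetric_Λ : LinearMap.IsSymmetric (𝕜 := ℂ) (E := PR.range) Λ

namespace VertexCondition

variable {G} [Finite E] {v : V}

/-- The vertex condition for the boundary values `F` and the outgoing derivatives `F'`. -/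
def Holds (C : G.VertexCondition v) (F F' : G.BdrySpace v) : Prop :=
  C.PD F = 0 ∧ C.PN F' = 0 ∧
    C.PR F' = (C.Λ ⟨C.PR F, LinearMap.mem_range_self C.PR.toLinearMap F⟩ : G.BdrySpace v)

/-- The vertex condition with the same projections and with `Λ` replaced by `c • Λ`. -/
def scaleStrength (c : ℝ) (C : G.VertexCondition v) : G.VertexCondition v where
  PD := C.PD
  PN := C.PN
  PR := C.PR
  isStarProjection_PD := C.isStarProjection_PD
  isStarProjection_PN := C.isStarProjection_PN
  isStarProjection_PR := C.isStarProjection_PR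
  range_PD_orthogonal_range_PN := C.range_PD_orthogonal_range_PN
  range_PD_orthogonal_range_PR := C.range_PD_orthogonal_range_PR
  range_PN_orthogonal_range_PR := C.range_PN_orthogonal_range_PR
  sum_eq_one := C.sum_eq_one
  Λ := (c : ℂ) • C.Λ
  isSymmetric_Λ := C.isSymmetric_Λ.smul (Complex.conj_ofReal c)

end VertexCondition

variable [Finite E] (v : V)

/-- The orthogonal projection onto the span of the vector `(1, …, 1)`. -/
def constProj : G.BdrySpace v →L[ℂ] G.BdrySpace v :=
  (Submodule.span ℂ {(WithLp.toLp 2 fun _ => 1 : G.BdrySpace v)}).starProjection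

/-- The orthogonal projection onto the orthogonal complement of `(1, …, 1)`. -/
def constProjCompl : G.BdrySpace v →L[ℂ] G.BdrySpace v :=
  (Submodule.span ℂ {(WithLp.toLp 2 fun _ => 1 : G.BdrySpace v)})ᗮ.starProjection

theorem constProjCompl_add_constProj : G.constProjCompl v + G.constProj v = 1 := by
  rw [constProjCompl, Submodule.starProjection_orthogonal', constProj, sub_add_cancel]

theorem range_constProjCompl_orthogonal :
    (G.constProjCompl v).range ⟂ (G.constProj v).range := by
  rw [constProjCompl, constProj, Submodule.range_starProjection, Submodule.range_starProjection]
  exact (Submodule.isOrtho_orthogonal_right _).symm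

/-- The `δ` coupling condition with strength `α`. -/
def deltaCondition (α : ℝ) : G.VertexCondition v where
  PD := G.constProjCompl v
  PN := 0
  PR := G.constProj v
  isStarProjection_PD := isStarProjection_starProjection
  isStarProjection_PN := .zero _
  isStarProjection_PR := isStarProjection_starProjection
  range_PD_orthogonal_range_PN := by simp
  range_PD_orthogonal_range_PR := G.range_constProjCompl_orthogonal v
  range_PN_orthogonal_range_PR := by simp
  sum_eq_one := by rw [add_zero, constProjCompl_add_constProj]
  Λ := ((α / G.deg v : ℝ) : ℂ) • LinearMap.id
  isSymmetric_Λ := LinearMap.IsSymmetric.id.smul (Complex.conj_ofReal _)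

/-- The `δ'` coupling condition with strength `β`, where `β ≠ 0`. -/
def deltaPrimeCondition (β : {β : ℝ // β ≠ 0}) : G.VertexCondition v where
  PD := 0
  PN := G.constProjCompl v
  PR := G.constProj v
  isStarProjection_PD := .zero _
  isStarProjection_PN := isStarProjection_starProjection
  isStarProjection_PR := isStarProjection_starProjection
  range_PD_orthogonal_range_PN := by simp
  range_PD_orthogonal_range_PR := by simp
  range_PN_orthogonal_range_PR := G.range_constProjCompl_orthogonal v
  sum_eq_one := by rw [zero_add, constProjCompl_add_constProj]
  Λ := ((G.deg v / β : ℝ) : ℂ) • LinearMap.id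
  isSymmetric_Λ := LinearMap.IsSymmetric.id.smul (Complex.conj_ofReal _)

end CombGraph

/-- A `δ` coupling of strength `α` or a `δ'` coupling of strength `β ≠ 0`. -/
inductive Coupling
  | delta (α : ℝ)
  | deltaPrime (β : {β : ℝ // β ≠ 0})

/-- The vertex condition given by a coupling. -/
def Coupling.toCondition {V E : Type*} [Finite E] (G : CombGraph V E) (v : V) :
    Coupling → G.VertexCondition v
  | .delta α => G.deltaCondition v α
  | .deltaPrime β => G.deltaPrimeCondition v β

/-- The rescaled coupling: `α` becomes `α / t` and `β` becomes `t β`. -/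
def Coupling.scale (t : ℝ) (ht : 0 < t) : Coupling → Coupling
  | .delta α => .delta (α / t)
  | .deltaPrime β => .deltaPrime ⟨t * β, mul_ne_zero ht.ne' β.2⟩

/-! ### Sobolev functions on an interval -/

/-- Lebesgue measure on the interval `(0, ℓ)`. -/
abbrev edgeMeasure (ℓ : ℝ) : Measure ℝ := volume.restrict (Ioo 0 ℓ)

/-- `g` is the weak derivative of `f` on `(0, ℓ)` (for integrable `f`, `g`). -/
def HasWeakDeriv (ℓ : ℝ) (f g : ℝ → ℂ) : Prop :=
  ∀ φ : ℝ → ℝ, ContDiff ℝ ∞ φ → HasCompactSupport φ → tsupport φ ⊆ Ioo 0 ℓ →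
    ∫ x, deriv φ x • f x ∂edgeMeasure ℓ = -∫ x, φ x • g x ∂edgeMeasure ℓ

theorem integrable_test_smul {ℓ : ℝ} {ψ : ℝ → ℝ} {f : ℝ → ℂ} (hψ : Continuous ψ)
    (hs : HasCompactSupport ψ) (hf : Integrable f (edgeMeasure ℓ)) :
    Integrable (fun x => ψ x • f x) (edgeMeasure ℓ) := by
  obtain ⟨C, hC⟩ := hψ.bounded_above_of_compact_support hs
  exact hf.bdd_smul C hψ.aestronglyMeasurable (.of_forall hC)

theorem HasWeakDeriv.add {ℓ : ℝ} {f g f₁ g₁ : ℝ → ℂ} (h : HasWeakDeriv ℓ f g)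
    (h₁ : HasWeakDeriv ℓ f₁ g₁) (hf : Integrable f (edgeMeasure ℓ))
    (hg : Integrable g (edgeMeasure ℓ)) (hf₁ : Integrable f₁ (edgeMeasure ℓ))
    (hg₁ : Integrable g₁ (edgeMeasure ℓ)) : HasWeakDeriv ℓ (f + f₁) (g + g₁) := by
  intro φ hφ hc ht
  have hd : Continuous (deriv φ) := hφ.continuous_deriv (by simp)
  simp only [Pi.add_apply, smul_add]
  rw [integral_add (integrable_test_smul hd hc.deriv hf) (integrable_test_smul hd hc.deriv hf₁),
    integral_add (integrable_test_smul hφ.continuous hc hg)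
      (integrable_test_smul hφ.continuous hc hg₁), h φ hφ hc ht, h₁ φ hφ hc ht]
  ring

theorem HasWeakDeriv.smul {ℓ : ℝ} {f g : ℝ → ℂ} (c : ℂ) (h : HasWeakDeriv ℓ f g) :
    HasWeakDeriv ℓ (c • f) (c • g) := by
  intro φ hφ hc ht
  simp only [Pi.smul_apply]
  simp_rw [smul_comm _ c]
  rw [integral_smul, integral_smul, h φ hφ hc ht, smul_neg]

theorem HasWeakDeriv.congr {ℓ : ℝ} {f g f₁ g₁ : ℝ → ℂ} (h : HasWeakDeriv ℓ f g)
    (hf : f =ᵐ[edgeMeasure ℓ] f₁) (hg : g =ᵐ[edgeMeasure ℓ] g₁) : HasWeakDeriv ℓ f₁ g₁ := by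
  intro φ hφ hc ht
  have e1 : ∫ x, deriv φ x • f₁ x ∂edgeMeasure ℓ = ∫ x, deriv φ x • f x ∂edgeMeasure ℓ :=
    integral_congr_ae (hf.mono fun x hx => congrArg (deriv φ x • ·) hx.symm)
  have e2 : ∫ x, φ x • g₁ x ∂edgeMeasure ℓ = ∫ x, φ x • g x ∂edgeMeasure ℓ :=
    integral_congr_ae (hg.mono fun x hx => congrArg (φ x • ·) hx.symm)
  rw [e1, e2]
  exact h φ hφ hc ht

theorem HasWeakDeriv.unique {ℓ : ℝ} {f g g₁ : ℝ → ℂ} (h : HasWeakDeriv ℓ f g)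
    (h₁ : HasWeakDeriv ℓ f g₁) (hg : Integrable g (edgeMeasure ℓ))
    (hg₁ : Integrable g₁ (edgeMeasure ℓ)) : g =ᵐ[edgeMeasure ℓ] g₁ := by
  have hint : Integrable (g - g₁) (edgeMeasure ℓ) := hg.sub hg₁
  have := isOpen_Ioo.ae_eq_zero_of_integral_contDiff_smul_eq_zero (U := Ioo 0 ℓ)
    (hint.locallyIntegrable.locallyIntegrableOn _) (fun φ hφ hc ht => by
      simp only [Pi.sub_apply, smul_sub]
      rw [integral_sub (integrable_test_smul hφ.continuous hc hg)
        (integrable_test_smul hφ.continuous hc hg₁)]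
      have e := (h φ hφ hc ht).symm.trans (h₁ φ hφ hc ht)
      rw [neg_inj] at e
      rw [e, sub_self])
  filter_upwards [this, ae_restrict_mem measurableSet_Ioo] with x hx hm
  exact sub_eq_zero.mp (hx hm)

theorem integrable_of_continuousOn {ℓ : ℝ} {u : ℝ → ℂ} (hu : ContinuousOn u (Icc 0 ℓ)) :
    Integrable u (edgeMeasure ℓ) :=
  (hu.integrableOn_Icc (μ := volume)).mono_set Ioo_subset_Icc_self

theorem integrable_Lp {ℓ : ℝ} (g : Lp ℂ 2 (edgeMeasure ℓ)) : Integrable g (edgeMeasure ℓ) :=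
  (Lp.memLp g).integrable (by norm_num)

/-! ### Schrödinger operators on metric graphs -/

namespace MetricGraph

variable {V E : Type*} (Γ : MetricGraph V E)

/-- The graph in which all lengths are multiplied by `t`. -/
def scale (t : ℝ) (ht : 0 < t) : MetricGraph V E where
  toCombGraph := Γ.toCombGraph
  len e := t * Γ.len e
  len_pos e := mul_pos ht (Γ.len_pos e)

/-- Real-valued potentials in `L^∞(Γ)`. -/
structure Potential where
  /-- the potential on each edge -/
  toFun : E → ℝ → ℝ
  memLp : ∀ e, MemLp (toFun e) ∞ (edgeMeasure (Γ.len e))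

/-- The potential `x ↦ t⁻² q (x / t)` on the scaled graph. -/
def Potential.scale {Γ : MetricGraph V E} (q : Γ.Potential) (t : ℝ) (ht : 0 < t) :
    (Γ.scale t ht).Potential where
  toFun e x := (1 / t ^ 2) * q.toFun e (x / t)
  memLp e := by
    have hmap : Measure.map (fun x : ℝ => x / t) (edgeMeasure (t * Γ.len e))
        = ENNReal.ofReal t • edgeMeasure (Γ.len e) := by
      have hpre : (fun x : ℝ => x / t) ⁻¹' (Ioo 0 (Γ.len e)) = Ioo 0 (t * Γ.len e) := by
        ext x
        simp only [mem_preimage, mem_Ioo, div_pos_iff_of_pos_right ht, div_lt_iff₀ ht,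
          mul_comm t]
      have hvol : Measure.map (fun x : ℝ => x / t) volume = ENNReal.ofReal t • volume := by
        have := Real.map_volume_mul_right (a := t⁻¹) (inv_ne_zero ht.ne')
        simpa [div_eq_mul_inv, abs_of_pos ht] using this
      rw [edgeMeasure, ← hpre, ← Measure.restrict_map (by fun_prop) measurableSet_Ioo, hvol,
        Measure.restrict_smul]
    have h1 : MemLp (q.toFun e) ∞ (Measure.map (fun x : ℝ => x / t)
        (edgeMeasure (t * Γ.len e))) := by
      rw [hmap]
      exact (q.memLp e).smul_measure ENNReal.ofReal_ne_top
    exact (h1.comp_of_map (by fun_prop)).const_mul _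

/-- The Hilbert space `L²(Γ)`, the direct sum of the spaces `L²(0, len e)`. -/
abbrev L2 [Fintype E] : Type _ := PiLp 2 fun e : E => Lp ℂ 2 (edgeMeasure (Γ.len e))

/-- The vector `F(v)` of boundary values at `v` of a function on the closed edges. -/
def bdryValues [Finite E] (u : E → ℝ → ℂ) (v : V) : Γ.BdrySpace v :=
  WithLp.toLp 2 fun h => if h.1.2 then u h.1.1 (Γ.len h.1.1) else u h.1.1 0

/-- The vector `F'(v)` of derivatives at `v`, taken in the direction out of `v` into the edges,
where `u'` is the derivative along the parametrization of the edges. -/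
def bdryDerivs [Finite E] (u' : E → ℝ → ℂ) (v : V) : Γ.BdrySpace v :=
  WithLp.toLp 2 fun h => if h.1.2 then -u' h.1.1 (Γ.len h.1.1) else u' h.1.1 0

variable [Fintype E]

/-- `f` lies in the Sobolev space `H²` of every edge, with second weak derivative `g`, and `u`,
`u'` are the continuous representatives on the closed edges of `f` and of its first weak
derivative. -/
structure IsSobolevTwo (f g : Γ.L2) (u u' : E → ℝ → ℂ) : Prop where
  continuousOn : ∀ e, ContinuousOn (u e) (Icc 0 (Γ.len e))
  continuousOn' : ∀ e, ContinuousOn (u' e) (Icc 0 (Γ.len e))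
  ae_eq : ∀ e, f e =ᵐ[edgeMeasure (Γ.len e)] u e
  weakDeriv : ∀ e, HasWeakDeriv (Γ.len e) (u e) (u' e)
  weakDeriv' : ∀ e, HasWeakDeriv (Γ.len e) (u' e) (g e)

variable {Γ}

theorem IsSobolevTwo.unique {f g g₁ : Γ.L2} {u u' u₁ u₁' : E → ℝ → ℂ}
    (h : Γ.IsSobolevTwo f g u u') (h₁ : Γ.IsSobolevTwo f g₁ u₁ u₁') : g = g₁ := by
  refine PiLp.ext fun e => Lp.ext ?_
  have hu : u e =ᵐ[edgeMeasure (Γ.len e)] u₁ e := (h.ae_eq e).symm.trans (h₁.ae_eq e)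
  have hu' := ((h.weakDeriv e).congr hu .rfl).unique (h₁.weakDeriv e)
    (integrable_of_continuousOn (h.continuousOn' e))
    (integrable_of_continuousOn (h₁.continuousOn' e))
  exact ((h.weakDeriv' e).congr hu' .rfl).unique (h₁.weakDeriv' e)
    (integrable_Lp _) (integrable_Lp _)

theorem IsSobolevTwo.add {f g f₁ g₁ : Γ.L2} {u u' u₁ u₁' : E → ℝ → ℂ}
    (h : Γ.IsSobolevTwo f g u u') (h₁ : Γ.IsSobolevTwo f₁ g₁ u₁ u₁') :
    Γ.IsSobolevTwo (f + f₁) (g + g₁) (u + u₁) (u' + u₁') where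
  continuousOn e := (h.continuousOn e).add (h₁.continuousOn e)
  continuousOn' e := (h.continuousOn' e).add (h₁.continuousOn' e)
  ae_eq e := (Lp.coeFn_add (f e) (f₁ e)).trans ((h.ae_eq e).add (h₁.ae_eq e))
  weakDeriv e := (h.weakDeriv e).add (h₁.weakDeriv e)
    (integrable_of_continuousOn (h.continuousOn e))
    (integrable_of_continuousOn (h.continuousOn' e))
    (integrable_of_continuousOn (h₁.continuousOn e))
    (integrable_of_continuousOn (h₁.continuousOn' e))
  weakDeriv' e := ((h.weakDeriv' e).add (h₁.weakDeriv' e)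
    (integrable_of_continuousOn (h.continuousOn' e)) (integrable_Lp _)
    (integrable_of_continuousOn (h₁.continuousOn' e)) (integrable_Lp _)).congr .rfl
      (Lp.coeFn_add (g e) (g₁ e)).symm

theorem IsSobolevTwo.smul {f g : Γ.L2} {u u' : E → ℝ → ℂ} (c : ℂ)
    (h : Γ.IsSobolevTwo f g u u') : Γ.IsSobolevTwo (c • f) (c • g) (c • u) (c • u') where
  continuousOn e := (h.continuousOn e).const_smul c
  continuousOn' e := (h.continuousOn' e).const_smul c
  ae_eq e := (Lp.coeFn_smul c (f e)).trans ((h.ae_eq e).const_smul c)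
  weakDeriv e := (h.weakDeriv e).smul c
  weakDeriv' e := ((h.weakDeriv' e).smul c).congr .rfl (Lp.coeFn_smul c (g e)).symm

theorem isSobolevTwo_zero : Γ.IsSobolevTwo 0 0 0 0 := by
  have h0 (e : E) : HasWeakDeriv (Γ.len e) 0 0 := fun φ _ _ _ => by simp
  exact ⟨fun e => continuousOn_const, fun e => continuousOn_const,
    fun e => Lp.coeFn_zero _ _ _, h0, fun e => (h0 e).congr .rfl (Lp.coeFn_zero _ _ _).symm⟩

theorem bdryValues_add (u u₁ : E → ℝ → ℂ) (v : V) :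
    Γ.bdryValues (u + u₁) v = Γ.bdryValues u v + Γ.bdryValues u₁ v := by
  ext h
  simp only [bdryValues, Pi.add_apply, PiLp.add_apply]
  split <;> rfl

theorem bdryValues_smul (c : ℂ) (u : E → ℝ → ℂ) (v : V) :
    Γ.bdryValues (c • u) v = c • Γ.bdryValues u v := by
  ext h
  simp only [bdryValues, Pi.smul_apply, PiLp.smul_apply]
  split <;> rfl

theorem bdryDerivs_add (u u₁ : E → ℝ → ℂ) (v : V) :
    Γ.bdryDerivs (u + u₁) v = Γ.bdryDerivs u v + Γ.bdryDerivs u₁ v := by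
  ext h
  simp only [bdryDerivs, Pi.add_apply, PiLp.add_apply]
  split
  · exact neg_add _ _
  · rfl

theorem bdryDerivs_smul (c : ℂ) (u : E → ℝ → ℂ) (v : V) :
    Γ.bdryDerivs (c • u) v = c • Γ.bdryDerivs u v := by
  ext h
  simp only [bdryDerivs, Pi.smul_apply, PiLp.smul_apply]
  split
  · exact (smul_neg _ _).symm
  · rfl

variable (Γ)

/-- The domain of the Schrödinger operator with vertex conditions `C`. -/
def schrodingerDomain (C : ∀ v, Γ.VertexCondition v) : Submodule ℂ Γ.L2 where
  carrier := {f | ∃ g u u', Γ.IsSobolevTwo f g u u' ∧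
    ∀ v, (C v).Holds (Γ.bdryValues u v) (Γ.bdryDerivs u' v)}
  zero_mem' := by
    refine ⟨0, 0, 0, isSobolevTwo_zero, fun v => ?_⟩
    have h1 : Γ.bdryValues 0 v = 0 := by simpa using bdryValues_smul (Γ := Γ) 0 0 v
    have h2 : Γ.bdryDerivs 0 v = 0 := by simpa using bdryDerivs_smul (Γ := Γ) 0 0 v
    rw [h1, h2]
    refine ⟨map_zero _, map_zero _, ?_⟩
    have : (⟨(C v).PR 0, LinearMap.mem_range_self (C v).PR.toLinearMap 0⟩ : (C v).PR.range) = 0 :=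
      Subtype.ext (map_zero _)
    rw [this, map_zero, map_zero]
    rfl
  add_mem' := by
    rintro f f₁ ⟨g, u, u', h, hC⟩ ⟨g₁, u₁, u₁', h₁, hC₁⟩
    refine ⟨g + g₁, u + u₁, u' + u₁', h.add h₁, fun v => ?_⟩
    obtain ⟨a, b, c⟩ := hC v
    obtain ⟨a₁, b₁, c₁⟩ := hC₁ v
    rw [bdryValues_add, bdryDerivs_add]
    refine ⟨by rw [map_add, a, a₁, add_zero], by rw [map_add, b, b₁, add_zero], ?_⟩
    rw [map_add, c, c₁, ← Submodule.coe_add, ← map_add]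
    congr 2
    exact Subtype.ext (map_add _ _ _).symm
  smul_mem' := by
    rintro c f ⟨g, u, u', h, hC⟩
    refine ⟨c • g, c • u, c • u', h.smul c, fun v => ?_⟩
    obtain ⟨a, b, d⟩ := hC v
    rw [bdryValues_smul, bdryDerivs_smul]
    refine ⟨by rw [map_smul, a, smul_zero], by rw [map_smul, b, smul_zero], ?_⟩
    rw [map_smul, d, ← Submodule.coe_smul, ← map_smul]
    congr 2
    exact Subtype.ext (map_smul _ _ _).symm

variable {Γ}

/-- The second weak derivative of a function in the domain. -/
def secondDeriv {C : ∀ v, Γ.VertexCondition v} (f : Γ.schrodingerDomain C) : Γ.L2 :=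
  Classical.choose f.2

theorem secondDeriv_eq {C : ∀ v, Γ.VertexCondition v} (f : Γ.schrodingerDomain C) {g : Γ.L2}
    {u u' : E → ℝ → ℂ} (h : Γ.IsSobolevTwo f g u u') : secondDeriv f = g := by
  obtain ⟨u₁, u₁', h₁, _⟩ := Classical.choose_spec f.2
  exact h₁.unique h

theorem exists_isSobolevTwo_secondDeriv {C : ∀ v, Γ.VertexCondition v}
    (f : Γ.schrodingerDomain C) : ∃ u u', Γ.IsSobolevTwo f (secondDeriv f) u u' := by
  obtain ⟨u, u', h, _⟩ := Classical.choose_spec f.2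
  exact ⟨u, u', h⟩

/-- The product `q f` in `L²(Γ)`. -/
def Potential.mul (q : Γ.Potential) (f : Γ.L2) : Γ.L2 :=
  WithLp.toLp 2 fun e =>
    MemLp.toLp (q.toFun e • ⇑(f e)) ((Lp.memLp (f e)).smul (q.memLp e))

theorem Potential.coeFn_mul (q : Γ.Potential) (f : Γ.L2) (e : E) :
    q.mul f e =ᵐ[edgeMeasure (Γ.len e)] q.toFun e • ⇑(f e) :=
  MemLp.coeFn_toLp ((Lp.memLp (f e)).smul (q.memLp e))

theorem Potential.mul_add (q : Γ.Potential) (f f₁ : Γ.L2) :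
    q.mul (f + f₁) = q.mul f + q.mul f₁ := by
  refine PiLp.ext fun e => Lp.ext ?_
  filter_upwards [q.coeFn_mul (f + f₁) e, q.coeFn_mul f e, q.coeFn_mul f₁ e,
    Lp.coeFn_add (f e) (f₁ e), Lp.coeFn_add (q.mul f e) (q.mul f₁ e)] with x h1 h2 h3 h4 h5
  rw [PiLp.add_apply] at h1 ⊢
  simp only [Pi.smul_apply', Pi.add_apply] at *
  rw [h1, h5, h4, h2, h3, smul_add]

theorem Potential.mul_smul (q : Γ.Potential) (c : ℂ) (f : Γ.L2) :
    q.mul (c • f) = c • q.mul f := by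
  refine PiLp.ext fun e => Lp.ext ?_
  filter_upwards [q.coeFn_mul (c • f) e, q.coeFn_mul f e,
    Lp.coeFn_smul c (f e), Lp.coeFn_smul c (q.mul f e)] with x h1 h2 h3 h4
  rw [PiLp.smul_apply] at h1 ⊢
  simp only [Pi.smul_apply', Pi.smul_apply] at *
  rw [h1, h4, h3, h2, smul_comm]

/-- The Schrödinger operator `f ↦ -f'' + q f` in `L²(Γ)` with vertex conditions `C`. -/
def schrodinger (Γ : MetricGraph V E) (q : Γ.Potential) (C : ∀ v, Γ.VertexCondition v) :
    Γ.L2 →ₗ.[ℂ] Γ.L2 where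
  domain := Γ.schrodingerDomain C
  toFun :=
    { toFun := fun f => -secondDeriv f + q.mul f
      map_add' := fun f f₁ => by
        obtain ⟨u, u', h⟩ := exists_isSobolevTwo_secondDeriv f
        obtain ⟨u₁, u₁', h₁⟩ := exists_isSobolevTwo_secondDeriv f₁
        rw [secondDeriv_eq (f + f₁) (h.add h₁), Submodule.coe_add, q.mul_add]
        abel
      map_smul' := fun c f => by
        obtain ⟨u, u', h⟩ := exists_isSobolevTwo_secondDeriv f
        rw [secondDeriv_eq (c • f) (h.smul c), Submodule.coe_smul, q.mul_smul, RingHom.id_apply,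
          smul_add, smul_neg] }

end MetricGraph

end

/-! The dilation `f ↦ f (· / t)` intertwines the two operators up to the factor `1 / t ^ 2`. Each
derivative of a dilated function produces a factor `t⁻¹`, so the second derivative gains `t⁻²`,
which is the factor built into the scaled potential. At a vertex the boundary values are unchanged
and the outgoing derivatives gain `t⁻¹`, which replacing `Λ` by `Λ / t` compensates exactly. Hence
the dilation maps the eigenspace of `H` at `μ` bijectively onto that of the scaled operator at `μ /
t ^ 2` (`scaleEquiv_mem_opEigenspace_iff`). It need not be unitary: a linear bijection already
preserves multiplicities. The rest is order theory: multiplication by `c > 0` preserves the ordering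
of the real line, so operators whose multiplicities agree under `μ ↦ c μ` have eigenvalues that
differ by the factor `c` (`eigenvalue_eq_mul`). Part (ii) is an instance of (i), since rescaling a
coupling divides its operator `Λ` by `t` (`Coupling.toCondition_scale`). -/

noncomputable section

/-! ### Ordered eigenvalues when the spectrum is multiplied by a positive constant -/

section EigenvalueScaling

variable {X Y : Type*} [AddCommGroup X] [Module ℂ X] [AddCommGroup Y] [Module ℂ Y]

/-- Multiplication by a positive number as a bijection of half-lines. -/
def iicMulEquiv {c : ℝ} (hc : 0 < c) (x : ℝ) : Iic x ≃ Iic (c * x) where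
  toFun := fun ⟨μ, hμ⟩ => ⟨c * μ, mul_le_mul_of_nonneg_left hμ hc.le⟩
  invFun := fun ⟨μ, hμ⟩ => ⟨c⁻¹ * μ, (inv_mul_le_iff₀ hc).2 hμ⟩
  left_inv _ := Subtype.ext (inv_mul_cancel_left₀ hc.ne' _)
  right_inv _ := Subtype.ext (mul_inv_cancel_left₀ hc.ne' _)

/-- The bijection of half-lines carries finite sets to finite sets and preserves the summands, so
the two suprema agree after reindexing. -/
theorem eigCount_mul {S : Y →ₗ.[ℂ] Y} {T : X →ₗ.[ℂ] X} {c : ℝ} (hc : 0 < c)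
    (h : ∀ μ : ℝ, eigMultiplicity S (c * μ) = eigMultiplicity T μ) (x : ℝ) :
    eigCount S (c * x) = eigCount T x := by
  refine ((iicMulEquiv hc x).finsetCongr.iSup_congr fun s => ?_).symm
  rw [Equiv.finsetCongr_apply, Finset.sum_map]
  exact Finset.sum_congr rfl fun μ _ => h μ

/-- Both bounds are checked against the members of the sets whose infima are taken, so the infimum
need be neither attained nor finite. Moving `c` across an inequality in `EReal` is multiplication by
the nonnegative real `c⁻¹`. -/
theorem eigenvalue_eq_mul {S : Y →ₗ.[ℂ] Y} {T : X →ₗ.[ℂ] X} {c : ℝ} (hc : 0 < c)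
    (h : ∀ μ : ℝ, eigMultiplicity S (c * μ) = eigMultiplicity T μ) (k : ℕ) :
    eigenvalue S k = (c : EReal) * eigenvalue T k := by
  have hinv : ((c : ℝ) : EReal) * ((c⁻¹ : ℝ) : EReal) = 1 := by
    rw [← EReal.coe_mul, mul_inv_cancel₀ hc.ne', EReal.coe_one]
  apply le_antisymm
  · have h1 : ((c⁻¹ : ℝ) : EReal) * eigenvalue S k ≤ eigenvalue T k := by
      refine le_iInf₂ fun x hx => ?_
      have h2 : eigenvalue S k ≤ ((c * x : ℝ) : EReal) :=
        iInf₂_le (c * x) (show (k : ℕ∞) ≤ _ by rw [eigCount_mul hc h]; exact hx)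
      calc ((c⁻¹ : ℝ) : EReal) * eigenvalue S k ≤ ((c⁻¹ : ℝ) : EReal) * ((c * x : ℝ) : EReal) :=
            mul_le_mul_of_nonneg_left h2 (EReal.coe_nonneg.2 (inv_pos.2 hc).le)
        _ = (x : EReal) := by rw [← EReal.coe_mul, inv_mul_cancel_left₀ hc.ne']
    calc eigenvalue S k = (c : EReal) * (((c⁻¹ : ℝ) : EReal) * eigenvalue S k) := by
          rw [← mul_assoc, hinv, one_mul]
      _ ≤ _ := mul_le_mul_of_nonneg_left h1 (EReal.coe_nonneg.2 hc.le)
  · refine le_iInf₂ fun x hx => ?_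
    have h2 : eigenvalue T k ≤ ((c⁻¹ * x : ℝ) : EReal) := by
      refine iInf₂_le (c⁻¹ * x) (show (k : ℕ∞) ≤ _ from ?_)
      rw [← eigCount_mul hc h, mul_inv_cancel_left₀ hc.ne']
      exact hx
    calc (c : EReal) * eigenvalue T k ≤ (c : EReal) * ((c⁻¹ * x : ℝ) : EReal) :=
          mul_le_mul_of_nonneg_left h2 (EReal.coe_nonneg.2 hc.le)
      _ = (x : EReal) := by rw [← EReal.coe_mul, mul_inv_cancel_left₀ hc.ne']

end EigenvalueScaling

/-! ### Dilations of an interval -/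

section Dilation

variable {a ℓ ℓ' : ℝ}

/-- The lengths are tied by an equation so that one statement serves both directions: `a = t⁻¹` from
the scaled edge to the original one, and `a = t` back, where the equation holds by `rfl`. -/
theorem map_mul_left_edgeMeasure (ha : 0 < a) (h : a * ℓ' = ℓ) :
    Measure.map (fun x : ℝ => a * x) (edgeMeasure ℓ')
      = ENNReal.ofReal a⁻¹ • edgeMeasure ℓ := by
  have hpre : (fun x : ℝ => a * x) ⁻¹' (Ioo 0 ℓ) = Ioo 0 ℓ' := by
    ext x
    simp only [mem_preimage, mem_Ioo, ← h, mul_pos_iff_of_pos_left ha, mul_lt_mul_iff_right₀ ha]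
  rw [edgeMeasure, ← hpre, ← Measure.restrict_map (by fun_prop) measurableSet_Ioo,
    Real.map_volume_mul_left ha.ne', abs_of_pos (inv_pos.2 ha), Measure.restrict_smul]

theorem quasiMeasurePreserving_mul_left (ha : 0 < a) (h : a * ℓ' = ℓ) :
    Measure.QuasiMeasurePreserving (fun x : ℝ => a * x) (edgeMeasure ℓ') (edgeMeasure ℓ) :=
  ⟨by fun_prop, by rw [map_mul_left_edgeMeasure ha h]; exact Measure.smul_absolutelyContinuous⟩

theorem integral_comp_mul_left_edgeMeasure (ha : 0 < a) (h : a * ℓ' = ℓ) (f : ℝ → ℂ) :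
    ∫ x, f (a * x) ∂edgeMeasure ℓ' = a⁻¹ • ∫ x, f x ∂edgeMeasure ℓ := by
  have := (Homeomorph.mulLeft₀ a ha.ne').measurableEmbedding.integral_map
    (μ := edgeMeasure ℓ') f
  simp only [Homeomorph.coe_mulLeft₀] at this
  rw [← this, map_mul_left_edgeMeasure ha h, integral_smul_measure,
    ENNReal.toReal_ofReal (inv_pos.2 ha).le]

theorem MeasureTheory.MemLp.comp_mul_left_edgeMeasure (ha : 0 < a) (h : a * ℓ' = ℓ)
    {p : ℝ≥0∞} {f : ℝ → ℂ} (hf : MemLp f p (edgeMeasure ℓ)) :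
    MemLp (fun x => f (a * x)) p (edgeMeasure ℓ') := by
  have h1 : MemLp f p (Measure.map (fun x : ℝ => a * x) (edgeMeasure ℓ')) := by
    rw [map_mul_left_edgeMeasure ha h]
    exact hf.smul_measure ENNReal.ofReal_ne_top
  exact h1.comp_of_map (by fun_prop)

/-- The chain rule, moved onto the test functions: a test function `φ` on `(0, ℓ')` is transported
to `φ (a⁻¹ ·)` on `(0, ℓ)`, where the hypothesis applies. -/
theorem HasWeakDeriv.comp_mul_left (ha : 0 < a) (h : a * ℓ' = ℓ) {f g : ℝ → ℂ}
    (hfg : HasWeakDeriv ℓ f g) :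
    HasWeakDeriv ℓ' (fun x => f (a * x)) (fun x => (a : ℂ) * g (a * x)) := by
  intro φ hφ hc ht
  set e : ℝ ≃ₜ ℝ := Homeomorph.mulLeft₀ a⁻¹ (inv_pos.2 ha).ne' with he
  have hψ : ContDiff ℝ ∞ fun x => φ (a⁻¹ * x) := hφ.comp (contDiff_const.mul contDiff_id)
  have hψc : HasCompactSupport fun x => φ (a⁻¹ * x) := hc.comp_homeomorph e
  have hψt : (tsupport fun x => φ (a⁻¹ * x)) ⊆ Ioo 0 ℓ := by
    have h1 : (tsupport fun x => φ (a⁻¹ * x)) = e ⁻¹' tsupport φ :=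
      tsupport_comp_eq_preimage φ e
    rw [h1]
    intro x hx
    have h2 := ht hx
    simp only [he, Homeomorph.coe_mulLeft₀, mem_Ioo, mul_pos_iff_of_pos_left (inv_pos.2 ha),
      inv_mul_lt_iff₀ ha, h] at h2
    exact h2
  have key := hfg _ hψ hψc hψt
  have hd : deriv (fun x => φ (a⁻¹ * x)) = fun x => a⁻¹ * deriv φ (a⁻¹ * x) := by
    funext x
    rw [deriv_comp_mul_left, smul_eq_mul]
  rw [hd] at key
  -- Both integrals in `key` are pulled back to `(0, ℓ')`. The Jacobian `a⁻¹` is common to them and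
  -- cancels; the `a⁻¹` from differentiating `φ (a⁻¹ ·)` survives and becomes the factor `a` of the
  -- weak derivative.
  have e1 := integral_comp_mul_left_edgeMeasure ha h fun x => (a⁻¹ * deriv φ (a⁻¹ * x)) • f x
  have e2 := integral_comp_mul_left_edgeMeasure ha h fun x => φ (a⁻¹ * x) • g x
  simp only [inv_mul_cancel_left₀ ha.ne'] at e1 e2
  rw [key, smul_neg, ← e2] at e1
  simp only [SemigroupAction.mul_smul, integral_smul] at e1
  have e3 : ∀ x, φ x • ((a : ℂ) * g (a * x)) = a • φ x • g (a * x) := fun x => by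
    rw [← Complex.real_smul, smul_comm]
  simp only [e3, integral_smul]
  rw [← smul_neg, ← e1, smul_inv_smul₀ ha.ne']

/-- The map `f ↦ f (a ·)` from `L²(0, a ℓ')` to `L²(0, ℓ')`. -/
def dilation (ha : 0 < a) (h : a * ℓ' = ℓ) :
    Lp ℂ 2 (edgeMeasure ℓ) →ₗ[ℂ] Lp ℂ 2 (edgeMeasure ℓ') where
  toFun f := ((Lp.memLp f).comp_mul_left_edgeMeasure ha h).toLp _
  map_add' f g := by
    rw [← MemLp.toLp_add]
    exact MemLp.toLp_congr _ _
      ((quasiMeasurePreserving_mul_left ha h).ae (Lp.coeFn_add f g))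
  map_smul' c f := by
    rw [RingHom.id_apply, ← MemLp.toLp_const_smul]
    exact MemLp.toLp_congr _ _
      ((quasiMeasurePreserving_mul_left ha h).ae (Lp.coeFn_smul c f))

theorem coeFn_dilation (ha : 0 < a) (h : a * ℓ' = ℓ) (f : Lp ℂ 2 (edgeMeasure ℓ)) :
    dilation ha h f =ᵐ[edgeMeasure ℓ'] fun x => f (a * x) :=
  MemLp.coeFn_toLp ((Lp.memLp f).comp_mul_left_edgeMeasure ha h)

theorem dilation_dilation {b : ℝ} (ha : 0 < a) (h : a * ℓ' = ℓ) (hb : 0 < b) (h' : b * ℓ = ℓ')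
    (hba : a * b = 1) (f : Lp ℂ 2 (edgeMeasure ℓ)) : dilation hb h' (dilation ha h f) = f := by
  refine Lp.ext ?_
  filter_upwards [coeFn_dilation hb h' (dilation ha h f),
    (quasiMeasurePreserving_mul_left hb h').ae (coeFn_dilation ha h f)] with x h1 h2
  rw [h1, h2, ← mul_assoc, hba, one_mul]

/-- `dilation` as a linear equivalence. -/
def dilationEquiv (ha : 0 < a) (h : a * ℓ' = ℓ) :
    Lp ℂ 2 (edgeMeasure ℓ) ≃ₗ[ℂ] Lp ℂ 2 (edgeMeasure ℓ') :=
  have h' : a⁻¹ * ℓ = ℓ' := by rw [← h, inv_mul_cancel_left₀ ha.ne']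
  { dilation ha h with
    invFun := dilation (inv_pos.2 ha) h'
    left_inv := dilation_dilation ha h _ h' (mul_inv_cancel₀ ha.ne')
    right_inv := dilation_dilation _ h' ha h (inv_mul_cancel₀ ha.ne') }

theorem coeFn_dilationEquiv (ha : 0 < a) (h : a * ℓ' = ℓ) (f : Lp ℂ 2 (edgeMeasure ℓ)) :
    dilationEquiv ha h f =ᵐ[edgeMeasure ℓ'] fun x => f (a * x) :=
  coeFn_dilation ha h f

theorem coeFn_dilationEquiv_symm (ha : 0 < a) (h : a * ℓ' = ℓ) (f : Lp ℂ 2 (edgeMeasure ℓ')) :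
    (dilationEquiv ha h).symm f =ᵐ[edgeMeasure ℓ] fun x => f (a⁻¹ * x) :=
  coeFn_dilation (inv_pos.2 ha) (by rw [← h, inv_mul_cancel_left₀ ha.ne']) f

end Dilation

/-! ### Scaling of Schrödinger operators -/

namespace CombGraph.VertexCondition

variable {V E : Type*} [Finite E] {G : CombGraph V E} {v : V}

/-- The Dirichlet part does not involve `F'`, the Neumann part is homogeneous in it, and in the
Robin part both sides acquire the same nonzero factor `c`. -/
theorem scaleStrength_holds_iff (C : G.VertexCondition v) {c : ℝ} (hc : c ≠ 0)
    (F F' : G.BdrySpace v) :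
    (C.scaleStrength c).Holds F ((c : ℂ) • F') ↔ C.Holds F F' := by
  have hc' : (c : ℂ) ≠ 0 := Complex.ofReal_ne_zero.2 hc
  have h2 : C.PN ((c : ℂ) • F') = 0 ↔ C.PN F' = 0 := by
    rw [map_smul, smul_eq_zero_iff_right hc']
  have h3 (y : C.PR.range) : C.PR ((c : ℂ) • F') = (((c : ℂ) • y : C.PR.range) : G.BdrySpace v)
      ↔ C.PR F' = y := by
    rw [map_smul, Submodule.coe_smul, smul_right_inj hc']
  exact and_congr Iff.rfl (and_congr h2 (h3 _))

end CombGraph.VertexCondition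

/-- The strength enters `Λ` as `α / d` for `δ` but as `d / β` for `δ'`. Dividing `α` by `t` and
multiplying `β` by `t` therefore both divide `Λ` by `t`, and the projections do not depend on the
strength. -/
theorem Coupling.toCondition_scale {V E : Type*} [Finite E] (G : CombGraph V E) (v : V)
    (c : Coupling) {t : ℝ} (ht : 0 < t) :
    (c.scale t ht).toCondition G v = (c.toCondition G v).scaleStrength (1 / t) := by
  cases c with
  | delta α =>
    have h : ((α / t / G.deg v : ℝ) : ℂ) = ((1 / t : ℝ) : ℂ) * ((α / G.deg v : ℝ) : ℂ) := by
      push_cast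
      ring
    simp only [scale, toCondition, CombGraph.deltaCondition,
      CombGraph.VertexCondition.scaleStrength, h, SemigroupAction.mul_smul]
    rfl
  | deltaPrime β =>
    have h : ((G.deg v / (t * β) : ℝ) : ℂ) = ((1 / t : ℝ) : ℂ) * ((G.deg v / β : ℝ) : ℂ) := by
      push_cast
      rw [div_mul_div_comm, one_mul]
    simp only [scale, toCondition, CombGraph.deltaPrimeCondition,
      CombGraph.VertexCondition.scaleStrength, h, SemigroupAction.mul_smul]
    rfl

/-! ### The dilation on a metric graph and the correspondence of eigenspaces -/

namespace MetricGraph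

variable {V E : Type*} (Γ : MetricGraph V E)

theorem inv_mul_scale_len {t : ℝ} (ht : 0 < t) (e : E) :
    t⁻¹ * (Γ.scale t ht).len e = Γ.len e :=
  inv_mul_cancel_left₀ ht.ne' _

/-- Dilation sends endpoints to endpoints. The scaled graph has the same underlying `CombGraph` by
definition, so both sides live in the same boundary space. -/
theorem bdryValues_scale [Finite E] {t : ℝ} (ht : 0 < t) (u : E → ℝ → ℂ) (v : V) :
    (Γ.scale t ht).bdryValues (fun e x => u e (t⁻¹ * x)) v = Γ.bdryValues u v := by
  simp only [bdryValues, inv_mul_scale_len, mul_zero]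
  rfl

variable [Fintype E]

theorem bdryDerivs_scale {t : ℝ} (ht : 0 < t) (c : ℂ) (u' : E → ℝ → ℂ) (v : V) :
    (Γ.scale t ht).bdryDerivs (fun e x => c * u' e (t⁻¹ * x)) v = c • Γ.bdryDerivs u' v := by
  rw [← bdryDerivs_smul]
  simp only [bdryDerivs, inv_mul_scale_len, mul_zero]
  rfl

/-- The linear bijection `f ↦ f (· / t)` between the `L²` spaces of `Γ` and of the scaled
graph. -/
def scaleEquiv {t : ℝ} (ht : 0 < t) : Γ.L2 ≃ₗ[ℂ] (Γ.scale t ht).L2 :=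
  (WithLp.linearEquiv 2 ℂ _).trans
    ((LinearEquiv.piCongrRight fun e =>
      dilationEquiv (inv_pos.2 ht) (Γ.inv_mul_scale_len ht e)).trans
        (WithLp.linearEquiv 2 ℂ _).symm)

variable {Γ}

theorem coeFn_scaleEquiv {t : ℝ} (ht : 0 < t) (f : Γ.L2) (e : E) :
    Γ.scaleEquiv ht f e =ᵐ[edgeMeasure ((Γ.scale t ht).len e)] fun x => f e (t⁻¹ * x) :=
  coeFn_dilationEquiv (inv_pos.2 ht) (Γ.inv_mul_scale_len ht e) (f e)

theorem coeFn_scaleEquiv_symm {t : ℝ} (ht : 0 < t) (f : (Γ.scale t ht).L2) (e : E) :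
    (Γ.scaleEquiv ht).symm f e =ᵐ[edgeMeasure (Γ.len e)] fun x => f e (t * x) := by
  have := coeFn_dilationEquiv_symm (inv_pos.2 ht) (Γ.inv_mul_scale_len ht e) (f e)
  rwa [inv_inv] at this

theorem mapsTo_mul_left_Icc {a ℓ ℓ' : ℝ} (ha : 0 < a) (h : a * ℓ' = ℓ) :
    MapsTo (fun x => a * x) (Icc 0 ℓ') (Icc 0 ℓ) := fun _ hx =>
  ⟨mul_nonneg ha.le hx.1, h ▸ mul_le_mul_of_nonneg_left hx.2 ha.le⟩

theorem IsSobolevTwo.scale {t : ℝ} (ht : 0 < t) {f g : Γ.L2} {u u' : E → ℝ → ℂ}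
    (h : Γ.IsSobolevTwo f g u u') :
    (Γ.scale t ht).IsSobolevTwo (Γ.scaleEquiv ht f)
      (((1 / t ^ 2 : ℝ) : ℂ) • Γ.scaleEquiv ht g)
      (fun e x => u e (t⁻¹ * x)) (fun e x => ((t⁻¹ : ℝ) : ℂ) * u' e (t⁻¹ * x)) where
  continuousOn e := (h.continuousOn e).comp (by fun_prop)
    (mapsTo_mul_left_Icc (inv_pos.2 ht) (Γ.inv_mul_scale_len ht e))
  continuousOn' e := continuousOn_const.mul ((h.continuousOn' e).comp (by fun_prop)
    (mapsTo_mul_left_Icc (inv_pos.2 ht) (Γ.inv_mul_scale_len ht e)))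
  ae_eq e := (coeFn_scaleEquiv ht f e).trans
    ((quasiMeasurePreserving_mul_left (inv_pos.2 ht) (Γ.inv_mul_scale_len ht e)).ae (h.ae_eq e))
  weakDeriv e := (h.weakDeriv e).comp_mul_left (inv_pos.2 ht) (Γ.inv_mul_scale_len ht e)
  weakDeriv' e := by
    refine (((h.weakDeriv' e).comp_mul_left (inv_pos.2 ht)
      (Γ.inv_mul_scale_len ht e)).smul ((t⁻¹ : ℝ) : ℂ)).congr .rfl ?_
    filter_upwards [coeFn_scaleEquiv ht g e,
      Lp.coeFn_smul ((1 / t ^ 2 : ℝ) : ℂ) (Γ.scaleEquiv ht g e)] with x h1 h2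
    rw [PiLp.smul_apply, h2]
    simp only [Pi.smul_apply, h1, smul_eq_mul]
    push_cast
    ring

/-- The inverse dilation is treated directly: scaling by `t⁻¹` a second time would give lengths `t⁻¹
* (t * Γ.len e)`, equal to those of `Γ` only after rewriting. -/
theorem IsSobolevTwo.of_scale {t : ℝ} (ht : 0 < t) {f g : (Γ.scale t ht).L2} {u u' : E → ℝ → ℂ}
    (h : (Γ.scale t ht).IsSobolevTwo f g u u') :
    Γ.IsSobolevTwo ((Γ.scaleEquiv ht).symm f) (((t ^ 2 : ℝ) : ℂ) • (Γ.scaleEquiv ht).symm g)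
      (fun e x => u e (t * x)) (fun e x => (t : ℂ) * u' e (t * x)) where
  continuousOn e := (h.continuousOn e).comp (by fun_prop) (mapsTo_mul_left_Icc ht rfl)
  continuousOn' e := continuousOn_const.mul
    ((h.continuousOn' e).comp (by fun_prop) (mapsTo_mul_left_Icc ht rfl))
  ae_eq e := (coeFn_scaleEquiv_symm ht f e).trans
    ((quasiMeasurePreserving_mul_left ht rfl).ae (h.ae_eq e))
  weakDeriv e := (h.weakDeriv e).comp_mul_left ht rfl
  weakDeriv' e := by
    refine (((h.weakDeriv' e).comp_mul_left ht rfl).smul (t : ℂ)).congr .rfl ?_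
    filter_upwards [coeFn_scaleEquiv_symm ht g e,
      Lp.coeFn_smul ((t ^ 2 : ℝ) : ℂ) ((Γ.scaleEquiv ht).symm g e)] with x h1 h2
    rw [PiLp.smul_apply, h2]
    simp only [Pi.smul_apply, h1, smul_eq_mul]
    push_cast
    ring

/-- The factor here equals the one that `IsSobolevTwo.scale` gives for the second derivative, so it
can be taken out of the whole expression `-f'' + q f`. -/
theorem Potential.scale_mul_scaleEquiv (q : Γ.Potential) {t : ℝ} (ht : 0 < t) (f : Γ.L2) :
    (q.scale t ht).mul (Γ.scaleEquiv ht f)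
      = ((1 / t ^ 2 : ℝ) : ℂ) • Γ.scaleEquiv ht (q.mul f) := by
  refine PiLp.ext fun e => Lp.ext ?_
  filter_upwards [(q.scale t ht).coeFn_mul (Γ.scaleEquiv ht f) e, coeFn_scaleEquiv ht f e,
    coeFn_scaleEquiv ht (q.mul f) e,
    Lp.coeFn_smul ((1 / t ^ 2 : ℝ) : ℂ) (Γ.scaleEquiv ht (q.mul f) e),
    (quasiMeasurePreserving_mul_left (inv_pos.2 ht) (Γ.inv_mul_scale_len ht e)).ae
      (q.coeFn_mul f e)] with x h1 h2 h3 h4 h5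
  rw [PiLp.smul_apply, h1, h4]
  simp only [Pi.smul_apply', Pi.smul_apply] at h5 ⊢
  rw [h2, h3, h5]
  change (1 / t ^ 2 * q.toFun e (x / t)) • f e (t⁻¹ * x) = _
  rw [div_eq_inv_mul x t, SemigroupAction.mul_smul, Complex.coe_smul]

/-- Since second weak derivatives are unique, the choice made in `secondDeriv` can be replaced by
any witness `g`; eigenvectors can then be transported together with their representatives. -/
theorem mem_opEigenspace_schrodinger {q : Γ.Potential} {C : ∀ v, Γ.VertexCondition v} {μ : ℂ}
    {f : Γ.L2} : f ∈ opEigenspace (Γ.schrodinger q C) μ ↔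
      ∃ g u u', Γ.IsSobolevTwo f g u u' ∧
        (∀ v, (C v).Holds (Γ.bdryValues u v) (Γ.bdryDerivs u' v)) ∧ -g + q.mul f = μ • f := by
  constructor
  · rintro ⟨hf, h⟩
    obtain ⟨g, u, u', hS, hC⟩ := id hf
    refine ⟨g, u, u', hS, hC, ?_⟩
    rw [← h, ← secondDeriv_eq (⟨f, hf⟩ : Γ.schrodingerDomain C) hS]
    rfl
  · rintro ⟨g, u, u', hS, hC, h⟩
    have hf : f ∈ Γ.schrodingerDomain C := ⟨g, u, u', hS, hC⟩
    refine ⟨hf, h ▸ ?_⟩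
    rw [← secondDeriv_eq (⟨f, hf⟩ : Γ.schrodingerDomain C) hS]
    rfl

theorem scaleEquiv_mem_opEigenspace_iff {q : Γ.Potential} {C : ∀ v, Γ.VertexCondition v}
    {t : ℝ} (ht : 0 < t) {μ : ℝ} {f : Γ.L2} :
    Γ.scaleEquiv ht f ∈ opEigenspace ((Γ.scale t ht).schrodinger (q.scale t ht)
        fun v => (C v).scaleStrength (1 / t)) ((1 / t ^ 2 * μ : ℝ) : ℂ) ↔
      f ∈ opEigenspace (Γ.schrodinger q C) (μ : ℂ) := by
  have ht2 : ((1 / t ^ 2 : ℝ) : ℂ) ≠ 0 :=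
    Complex.ofReal_ne_zero.2 (one_div_pos.2 (pow_pos ht 2)).ne'
  have heq (g : Γ.L2) : -(((1 / t ^ 2 : ℝ) : ℂ) • Γ.scaleEquiv ht g)
      + (q.scale t ht).mul (Γ.scaleEquiv ht f)
        = ((1 / t ^ 2 * μ : ℝ) : ℂ) • Γ.scaleEquiv ht f ↔ -g + q.mul f = (μ : ℂ) • f := by
    rw [q.scale_mul_scaleEquiv, Complex.ofReal_mul, SemigroupAction.mul_smul, ← smul_neg, ← smul_add,
      smul_right_inj ht2, ← map_neg, ← map_add, ← map_smul, (Γ.scaleEquiv ht).injective.eq_iff]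
  have hbdry (u u' : E → ℝ → ℂ) (v : V) : ((C v).scaleStrength (1 / t)).Holds
      ((Γ.scale t ht).bdryValues (fun e x => u e (t⁻¹ * x)) v)
      ((Γ.scale t ht).bdryDerivs (fun e x => ((t⁻¹ : ℝ) : ℂ) * u' e (t⁻¹ * x)) v) ↔
        (C v).Holds (Γ.bdryValues u v) (Γ.bdryDerivs u' v) := by
    rw [bdryValues_scale, bdryDerivs_scale, one_div]
    exact (C v).scaleStrength_holds_iff (inv_ne_zero ht.ne') _ _
  rw [mem_opEigenspace_schrodinger, mem_opEigenspace_schrodinger]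
  constructor
  · rintro ⟨g, u, u', hS, hC, h⟩
    have hS' := hS.of_scale ht
    rw [LinearEquiv.symm_apply_apply] at hS'
    refine ⟨_, _, _, hS', fun v => (hbdry _ _ v).1 ?_, (heq _).1 ?_⟩
    -- `hbdry` dilates the pulled-back functions `u (t ·)` and `t u' (t ·)` once more; the two
    -- dilations and the factors `t⁻¹` and `t` cancel, leaving `u` and `u'`.
    · have htc : (t : ℂ) ≠ 0 := Complex.ofReal_ne_zero.2 ht.ne'
      simp only [mul_inv_cancel_left₀ ht.ne', Complex.ofReal_inv, inv_mul_cancel_left₀ htc]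
      exact hC v
    -- The witness for the second derivative on `Γ` carries the factor `t ^ 2`, which cancels the `1
    -- / t ^ 2` of `heq`.
    · rw [map_smul, LinearEquiv.apply_symm_apply, smul_smul, ← Complex.ofReal_mul,
        one_div_mul_cancel (pow_pos ht 2).ne', Complex.ofReal_one, one_smul]
      exact h
  · rintro ⟨g, u, u', hS, hC, h⟩
    exact ⟨_, _, _, hS.scale ht, fun v => (hbdry _ _ v).2 (hC v), (heq g).2 h⟩

/-- `scaleEquiv` restricts to a linear equivalence of the two eigenspaces, which therefore have
equal rank. -/
theorem eigMultiplicity_schrodinger_scale (q : Γ.Potential) (C : ∀ v, Γ.VertexCondition v)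
    {t : ℝ} (ht : 0 < t) (μ : ℝ) :
    eigMultiplicity ((Γ.scale t ht).schrodinger (q.scale t ht)
        fun v => (C v).scaleStrength (1 / t)) (1 / t ^ 2 * μ)
      = eigMultiplicity (Γ.schrodinger q C) μ := by
  rw [eigMultiplicity, eigMultiplicity]
  refine congrArg _ ((Γ.scaleEquiv ht).ofSubmodules _ _ ?_).rank_eq.symm
  ext f
  obtain ⟨f, rfl⟩ := (Γ.scaleEquiv ht).surjective f
  rw [scaleEquiv_mem_opEigenspace_iff]
  exact (Γ.scaleEquiv ht).injective.mem_set_image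

end MetricGraph

end

theorem mainTheorem12 {V E : Type*} [Fintype V] [Fintype E] (Γ : MetricGraph V E)
    (q : Γ.Potential) (t : ℝ) (ht : 0 < t) :
    (∀ (C : ∀ v, Γ.VertexCondition v) (k : ℕ), 1 ≤ k →
      eigenvalue ((Γ.scale t ht).schrodinger (q.scale t ht)
          (fun v => (C v).scaleStrength (1 / t))) k
        = ((1 / t ^ 2 : ℝ) : EReal) * eigenvalue (Γ.schrodinger q C) k) ∧
    (∀ (c : V → Coupling) (k : ℕ), 1 ≤ k →
      eigenvalue ((Γ.scale t ht).schrodinger (q.scale t ht)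
          (fun v => ((c v).scale t ht).toCondition (Γ.scale t ht).toCombGraph v)) k
        = ((1 / t ^ 2 : ℝ) : EReal) *
          eigenvalue (Γ.schrodinger q (fun v => (c v).toCondition Γ.toCombGraph v)) k) := by
  have key (C : ∀ v, Γ.VertexCondition v) (k : ℕ) :=
    eigenvalue_eq_mul (one_div_pos.2 (pow_pos ht 2))
      (MetricGraph.eigMultiplicity_schrodinger_scale q C ht) k
  refine ⟨fun C k _ => key C k, fun c k _ => ?_⟩
  -- The rescaled couplings are the conditions of part (i) for the original couplings, so `key`
  -- applies to them.
  have hc : (fun v => ((c v).scale t ht).toCondition (Γ.scale t ht).toCombGraph v)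
      = fun v => ((c v).toCondition Γ.toCombGraph v).scaleStrength (1 / t) :=
    funext fun v => (c v).toCondition_scale _ v ht
  exact (congrArg (fun D => eigenvalue ((Γ.scale t ht).schrodinger (q.scale t ht) D) k) hc).trans
    (key _ k)
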